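/- Let $d\ge 2$. Let $\mathbb S^d\subset\mathbb R^{d+1}$ be the unit sphere with its (unnormalised) Lebesgue surface measure $dx$, and let $\mu_d=\int_{\mathbb S^d}dx$. For $\ell\in\mathbb N=\{0,1,2,\dots\}$ let $G_{\ell;d}$ be the Gegenbauer polynomial of degree $\ell$, i.e. the Jacobi polynomial with parameters $\alpha=\beta=\frac d2-1$ normalised by $G_{\ell;d}(1)=1$. Let $n_{\ell;d}=\frac{2\ell+d-1}{\ell}\binom{\ell+d-2}{\ell-1}$ for $\ell\ge 1$ and $n_{0;d}=1$; this is the dimension of the space of real hyperspherical harmonics of degree $\ell$ (restrictions to $\mathbb S^d$ of homogeneous harmonic polynomials of degree $\ell$ in $d+1$ variables). (a) (Product formula for Gaunt integrals.) Let $\ell\in\mathbb N$ and let $(Y_{\ell,m})_{m=1}^{n_{\ell;d}}$ be an orthonormal basis, in $L^2(\mathbb S^d)$, of the space of real hyperspherical harmonics of degree $\ell$. For $k_1,\dots,k_p\in\{1,\dots,n_{\ell;d}\}$ put $\mathcal G_{k_1,\dots,k_p}=\int_{\mathbb S^d}\prod_{i=1}^pY_{\ell,k_i}(x)\,dx$.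 Then for all $r,q\in\mathbb N$ and $n,k_1,\dots,k_q\in\{1,\dots,n_{\ell;d}\}$, $$\sum_{m_1,\dots,m_r=1}^{n_{\ell;d}}\mathcal G_{m_1,\dots,m_r,n}\,\mathcal G_{m_1,\dots,m_r,k_1,\dots,k_q}=\Big(\frac{n_{\ell;d}}{\mu_d}\Big)^{r-1}\hat\gamma_{\ell;r}\,\mathcal G_{n,k_1,\dots,k_q},\qquad \hat\gamma_{\ell;r}=n_{\ell;d}\frac{\mu_{d-1}}{\mu_d}\int_{-1}^1G_{\ell;d}(t)^{r+1}\big(\sqrt{1-t^2}\big)^{d-2}dt.$$ (b) (Cross moments of Gegenbauer polynomials.) There exist positive constants $c_{d,1},c_{d,2},c_{d,3}$, depending only on $d$, such that the following hold for every $\ell\in\mathbb N$. 1. For all integers $q_1,q_2\ge 2$, $$\int_{(\mathbb S^d)^3}G_{\ell;d}(\langle x_1,x_2\rangle)\,G_{\ell;d}(\langle x_1,x_3\rangle)^{q_1}\,G_{\ell;d}(\langle x_2,x_3\rangle)^{q_2}\,dx_1dx_2dx_3=c_{d,1}\prod_{i=1}^2\int_{(\mathbb S^d)^2}G_{\ell;d}(\langle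 x,y\rangle)^{q_i+1}dx\,dy.$$ 2. For all integers $q_1,q_2\ge 2$ and $q_3\ge 1$, $$\int_{(\mathbb S^d)^4}G_{\ell;d}(\langle x_1,x_2\rangle)\,G_{\ell;d}(\langle x_1,x_4\rangle)^{q_1}\,G_{\ell;d}(\langle x_2,x_3\rangle)^{q_2}\,G_{\ell;d}(\langle x_3,x_4\rangle)^{q_3}\,dx_1dx_2dx_3dx_4=c_{d,2}\prod_{i=1}^3\int_{(\mathbb S^d)^2}G_{\ell;d}(\langle x,y\rangle)^{q_i+1}dx\,dy.$$ 3. For all integers $q_1,q_2\ge 2$ and $q_3\ge 0$, $$\int_{(\mathbb S^d)^4}G_{\ell;d}(\langle x_1,x_2\rangle)\,G_{\ell;d}(\langle x_1,x_4\rangle)^{q_1}\,G_{\ell;d}(\langle x_2,x_3\rangle)^{q_2}\,G_{\ell;d}(\langle x_2,x_4\rangle)^{q_3}\,G_{\ell;d}(\langle x_3,x_4\rangle)\,dx_1dx_2dx_3dx_4$$ $$=c_{d,3}\int_{(\mathbb S^d)^2}G_{\ell;d}(\langle x,y\rangle)^{q_1+1}dx\,dy\int_{(\mathbb S^d)^2}G_{\ell;d}(\langle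 x,y\rangle)^{q_2+1}dx\,dy\int_{(\mathbb S^d)^2}G_{\ell;d}(\langle x,y\rangle)^{q_3+2}dx\,dy.$$ -/

import Mathlib

open MeasureTheory
open scoped Polynomial

/-- The unit sphere `𝕊^d ⊂ ℝ^(d+1)`. -/
abbrev USphere (d : ℕ) : Type :=
  Metric.sphere (0 : EuclideanSpace ℝ (Fin (d + 1))) 1

/-- The Lebesgue (surface) measure on `𝕊^d`, not normalised. -/
noncomputable def sphereMeasure (d : ℕ) : Measure (USphere d) :=
  (volume : Measure (EuclideanSpace ℝ (Fin (d + 1)))).toSphere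

instance instIsFiniteMeasureSphereMeasure (d : ℕ) : IsFiniteMeasure (sphereMeasure d) := by
  unfold sphereMeasure
  infer_instance

/-- The product measure `dx₁ ⋯ dx_k` on `(𝕊^d)^k`. -/
noncomputable def sphereMeasurePow (d k : ℕ) : Measure (Fin k → USphere d) :=
  Measure.pi fun _ => sphereMeasure d

/-- The total surface measure `μ_d` of `𝕊^d`. -/
noncomputable def sphereArea (d : ℕ) : ℝ := (sphereMeasure d).real Set.univ

/-- The inner product in `ℝ^(d+1)` of two points of `𝕊^d`. -/
noncomputable def sphereInner {d : ℕ} (x y : USphere d) : ℝ :=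
  inner ℝ (x : EuclideanSpace ℝ (Fin (d + 1))) (y : EuclideanSpace ℝ (Fin (d + 1)))

/-- The Gegenbauer polynomial `G_{ℓ;d}`, i.e. the Jacobi polynomial of degree `ℓ` with
`α = β = d/2 - 1`, normalised by `G_{ℓ;d}(1) = 1`, through its three-term recurrence
`(ℓ + d) G_{ℓ+2} = (2ℓ + d + 1) t G_{ℓ+1} - (ℓ + 1) G_ℓ`, `G_0 = 1`, `G_1 = t`.
For `d = 2` these are the Legendre polynomials. -/
noncomputable def gegenbauer (d : ℕ) : ℕ → ℝ[X]
  | 0 => 1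
  | 1 => Polynomial.X
  | ℓ + 2 =>
      Polynomial.C (((ℓ : ℝ) + d)⁻¹) *
        (Polynomial.C (2 * (ℓ : ℝ) + d + 1) * Polynomial.X * gegenbauer d (ℓ + 1)
          - Polynomial.C ((ℓ : ℝ) + 1) * gegenbauer d ℓ)

/-- The normalisation `G_{ℓ;d}(1) = 1`. -/
theorem gegenbauer_eval_one (d : ℕ) (hd : 1 ≤ d) :
    ∀ ℓ : ℕ, (gegenbauer d ℓ).eval 1 = 1
  | 0 => by simp [gegenbauer]
  | 1 => by simp [gegenbauer]
  | ℓ + 2 => by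
      have h1 := gegenbauer_eval_one d hd (ℓ + 1)
      have h0 := gegenbauer_eval_one d hd ℓ
      have hd' : (1 : ℝ) ≤ d := by exact_mod_cast hd
      have hne : (ℓ : ℝ) + d ≠ 0 := by positivity
      simp only [gegenbauer, Polynomial.eval_mul, Polynomial.eval_sub, Polynomial.eval_C,
        Polynomial.eval_X, h1, h0]
      field_simp
      ring

/-- The kernel `(x, y) ↦ G_{ℓ;d}(⟨x, y⟩)` on `𝕊^d × 𝕊^d`. -/
noncomputable def gegK (d ℓ : ℕ) (x y : USphere d) : ℝ :=
  (gegenbauer d ℓ).eval (sphereInner x y)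

/-- The double moment `∫_{(𝕊^d)²} G_{ℓ;d}(⟨x, y⟩)^p dx dy`. -/
noncomputable def gegMoment (d ℓ p : ℕ) : ℝ :=
  ∫ x : Fin 2 → USphere d, gegK d ℓ (x 0) (x 1) ^ p ∂(sphereMeasurePow d 2)

/-- The number `n_{ℓ;d} = ((2ℓ + d - 1) / ℓ) * binom(ℓ + d - 2, ℓ - 1)`, with `n_{0;d} = 1`.
For `d ≥ 2` the division is exact, see `harmDim_cast`. -/
def harmDim (d ℓ : ℕ) : ℕ :=
  if ℓ = 0 then 1 else (2 * ℓ + d - 1) * (ℓ + d - 2).choose (ℓ - 1) / ℓ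

theorem harmDim_cast (d ℓ : ℕ) (hd : 2 ≤ d) (hℓ : 1 ≤ ℓ) :
    (harmDim d ℓ : ℝ) =
      (2 * (ℓ : ℝ) + d - 1) / ℓ * ((ℓ + d - 2).choose (ℓ - 1) : ℝ) := by
  obtain ⟨e, rfl⟩ := Nat.exists_eq_add_of_le hd
  obtain ⟨k, rfl⟩ := Nat.exists_eq_add_of_le hℓ
  have e1 : 1 + k + (2 + e) - 2 = k + e + 1 := by omega
  have e2 : 1 + k - 1 = k := by omega
  have e3 : 2 * (1 + k) + (2 + e) - 1 = (k + 1) + (k + e + 1 + 1) := by omega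
  have hdvd : (1 + k) ∣ ((k + 1) + (k + e + 1 + 1)) * (k + e + 1).choose k := by
    rw [add_mul, Nat.add_one_mul_choose_eq, add_comm 1 k]
    exact Dvd.dvd.add (dvd_mul_right _ _) (dvd_mul_left _ _)
  have hne : ((1 + k : ℕ) : ℝ) ≠ 0 := by positivity
  unfold harmDim
  rw [if_neg (by omega), e1, e2, e3, Nat.cast_div hdvd hne]
  push_cast
  ring

/-- The Laplace operator of `ℝ^(d+1)` on polynomials in `d + 1` variables. -/
noncomputable def polyLaplacian (d : ℕ) :
    MvPolynomial (Fin (d + 1)) ℝ →ₗ[ℝ] MvPolynomial (Fin (d + 1)) ℝ :=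
  ∑ i, (MvPolynomial.pderiv i).toLinearMap ∘ₗ (MvPolynomial.pderiv i).toLinearMap

/-- Restriction of a polynomial in `d + 1` variables to the sphere `𝕊^d`. -/
noncomputable def polyRestrict (d : ℕ) :
    MvPolynomial (Fin (d + 1)) ℝ →ₗ[ℝ] (USphere d → ℝ) :=
  LinearMap.pi fun x => (MvPolynomial.aeval fun i => x.1 i).toLinearMap

/-- The real hyperspherical harmonics of degree `ℓ` on `𝕊^d`: the restrictions to `𝕊^d` of the
homogeneous harmonic polynomials of degree `ℓ` in `d + 1` variables. -/
noncomputable def sphericalHarmonics (d ℓ : ℕ) : Submodule ℝ (USphere d → ℝ) :=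
  (MvPolynomial.homogeneousSubmodule (Fin (d + 1)) ℝ ℓ ⊓
    LinearMap.ker (polyLaplacian d)).map (polyRestrict d)

/-- `(Y_{ℓ,m;d})_m`, `m` ranging over `n_{ℓ;d}` indices, is an orthonormal basis, for the inner
product of `L²(𝕊^d)`, of the space of hyperspherical harmonics of degree `ℓ`. -/
structure IsHarmonicONB (d ℓ : ℕ) (Y : Fin (harmDim d ℓ) → USphere d → ℝ) : Prop where
  span_eq : Submodule.span ℝ (Set.range Y) = sphericalHarmonics d ℓ
  orthonormal : ∀ m m', ∫ x, Y m x * Y m' x ∂(sphereMeasure d) = if m = m' then 1 else 0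

/-- The generalized Gaunt integral `∫_{𝕊^d} ∏ᵢ Y_{ℓ,kᵢ;d}(x) dx` of order `q`. -/
noncomputable def gaunt {d ℓ q : ℕ} (Y : Fin (harmDim d ℓ) → USphere d → ℝ)
    (k : Fin q → Fin (harmDim d ℓ)) : ℝ :=
  ∫ x, ∏ i, Y (k i) x ∂(sphereMeasure d)

/-- `γ̂_{ℓ;r} = n_{ℓ;d} (μ_{d-1} / μ_d) ∫_{-1}^1 G_{ℓ;d}(t)^(r+1) (√(1 - t²))^(d-2) dt`. -/
noncomputable def gammaHat (d ℓ r : ℕ) : ℝ :=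
  (harmDim d ℓ : ℝ) * (sphereArea (d - 1) / sphereArea d) *
    ∫ t in (-1 : ℝ)..1, (gegenbauer d ℓ).eval t ^ (r + 1) * Real.sqrt (1 - t ^ 2) ^ (d - 2)

/-!
All parts of the theorem rest on the Funk-Hecke formula for the powers of the Gegenbauer kernel:
`∫ G(⟨x, y⟩)^p Y(x) dx = λ_p Y(y)` for every hyperspherical harmonic `Y` of degree `ℓ`, where
`G = G_{ℓ;d}` and `λ_p = ∫ G(⟨x, y⟩)^(p+1) dx` (`integral_gegK_pow_mul`).

It is obtained without averaging over rotations. Comparing Gaussian integrals of a homogeneous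
polynomial `P` of degree `m` and of `ΔP`, monomial by monomial, and passing to polar coordinates
gives `∫ ΔP = m (m + d - 1) ∫ P` over the sphere (`integral_polyLaplacian`). For
`P = ⟨·, y⟩^k Y` with `Y` harmonic, this expresses `∫ ⟨x, y⟩^k Y(x) dx` through the same integral
with `k - 2` in place of `k`, and the one with exponent `k - 1` for the harmonic polynomial `∂_y Y`.
Since `∂_y Y (y) = ℓ Y(y)`, induction on `k` shows that the integral is a multiple of `Y(y)`, by a
factor depending on `k`, `ℓ` and `d` only (`exists_integral_pow_mul_harmonic`). The eigenvalue is
then read off from the zonal harmonic `Y = G(⟨·, y⟩)`, evaluated at its pole; that it is a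
hyperspherical harmonic follows from the three-term recurrence together with the Appell property
`∂_y Z_{ℓ+1} = (ℓ + 1) Z_ℓ` of the homogenised polynomials (`dirDeriv_zonalPoly`).

For the Gaunt integrals, expanding `G(⟨·, y⟩)` in the orthonormal basis and using the case `p = 1`
gives the addition formula (`sum_harmonic_mul_harmonic`), so that the sum over `m₁, …, m_r` becomes
a power of `G` under a double integral, to which the Funk-Hecke formula applies. The moments
`∫ ⟨x, y⟩^k dx` satisfy the recursion of the corresponding trigonometric integrals, which identifies
`λ_p` with the one-dimensional integral in `γ̂` (`gegEigen_eq_integral`).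

For the cross moments, a vertex joined to its only two neighbours by a simple edge and an edge of
multiplicity `q` can be integrated out: this gives the factor `λ_q`, a multiple of a double moment,
and joins the two neighbours by a further simple edge.
-/

/-! ### Gaussian moments and integrals over the sphere -/

theorem integrable_pow_mul_exp_neg_sq (a : ℕ) :
    Integrable fun x : ℝ => x ^ a * Real.exp (-x ^ 2) := by
  have h := integrable_rpow_mul_exp_neg_mul_sq (b := 1) one_pos (s := a)
    (by have := (Nat.cast_nonneg a : (0 : ℝ) ≤ a); linarith)
  simpa using h

/-- Integration by parts for the Gaussian weight, in the form in which it applies to each variable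
of a monomial. Where a natural subtraction truncates, its coefficient vanishes. -/
theorem gaussian_moment_deriv (a : ℕ) :
    ((a : ℝ) * (a - 1 : ℕ)) * ∫ x : ℝ, x ^ (a - 2) * Real.exp (-x ^ 2) =
      2 * a * ∫ x : ℝ, x ^ a * Real.exp (-x ^ 2) := by
  rcases a with _ | a
  · simp
  have h := integral_mul_deriv_eq_deriv_mul_of_integrable
    (u := fun x : ℝ => x ^ a) (u' := fun x => a * x ^ (a - 1))
    (v := fun x => Real.exp (-x ^ 2)) (v' := fun x => Real.exp (-x ^ 2) * (-(2 * x)))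
    (fun x _ => hasDerivAt_pow a x)
    (fun x _ => by simpa using ((hasDerivAt_pow 2 x).neg).exp)
    (by
      refine ((integrable_pow_mul_exp_neg_sq (a + 1)).const_mul (-2)).congr (.of_forall fun x => ?_)
      simp only [Pi.mul_apply]; ring)
    (by
      refine ((integrable_pow_mul_exp_neg_sq (a - 1)).const_mul a).congr (.of_forall fun x => ?_)
      simp only [Pi.mul_apply]; ring)
    (integrable_pow_mul_exp_neg_sq a)
  have h1 : ∫ x : ℝ, x ^ a * (Real.exp (-x ^ 2) * (-(2 * x))) =
      -2 * ∫ x : ℝ, x ^ (a + 1) * Real.exp (-x ^ 2) := by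
    rw [← integral_const_mul]; congr 1; ext x; ring
  have h2 : ∫ x : ℝ, a * x ^ (a - 1) * Real.exp (-x ^ 2) =
      a * ∫ x : ℝ, x ^ (a - 1) * Real.exp (-x ^ 2) := by
    rw [← integral_const_mul]; congr 1; ext x; ring
  rw [h1, h2] at h
  have e1 : a + 1 - 2 = a - 1 := by omega
  rw [e1, Nat.add_sub_cancel]
  push_cast
  linear_combination ((a : ℝ) + 1) * h

/-- The radial moment `∫₀^∞ r^k exp(-r²) dr`. -/
noncomputable def radialMoment (k : ℕ) : ℝ :=
  ∫ r in Set.Ioi (0 : ℝ), r ^ k * Real.exp (-r ^ 2)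

theorem radialMoment_eq (k : ℕ) : radialMoment k = 1 / 2 * Real.Gamma (((k : ℝ) + 1) / 2) := by
  have h := integral_rpow_mul_exp_neg_rpow (p := 2) (q := k) (by norm_num)
    (by have := (Nat.cast_nonneg k : (0 : ℝ) ≤ k); linarith)
  rw [← h, radialMoment]
  simp

theorem radialMoment_pos (k : ℕ) : 0 < radialMoment k := by
  rw [radialMoment_eq]
  have := Real.Gamma_pos_of_pos (show (0 : ℝ) < ((k : ℝ) + 1) / 2 by positivity)
  positivity

theorem radialMoment_add_two (k : ℕ) :
    radialMoment (k + 2) = ((k : ℝ) + 1) / 2 * radialMoment k := by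
  have : (((k + 2 : ℕ) : ℝ) + 1) / 2 = ((k : ℝ) + 1) / 2 + 1 := by push_cast; ring
  rw [radialMoment_eq, radialMoment_eq, this, Real.Gamma_add_one (by positivity)]
  ring

/-- Integration of a homogeneous function against the Gaussian weight, in polar coordinates. -/
theorem integral_gaussian_of_homogeneous (d m : ℕ) (F : EuclideanSpace ℝ (Fin (d + 1)) → ℝ)
    (hF : ∀ (r : ℝ) x, F (r • x) = r ^ m * F x) :
    ∫ x, F x * Real.exp (-‖x‖ ^ 2) =
      radialMoment (m + d) * ∫ x : USphere d, F x ∂(sphereMeasure d) := by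
  let E := EuclideanSpace ℝ (Fin (d + 1))
  have hdim : Module.finrank ℝ E - 1 = d := by simp [E]
  calc
    ∫ x : E, F x * Real.exp (-‖x‖ ^ 2)
      = ∫ x : ({(0)}ᶜ : Set E), F x.1 * Real.exp (-‖x.1‖ ^ 2) ∂((volume : Measure E).comap (↑)) := by
        rw [integral_subtype_comap (measurableSet_singleton _).compl
          fun x : E => F x * Real.exp (-‖x‖ ^ 2), restrict_compl_singleton]
    _ = ∫ p : USphere d × Set.Ioi (0 : ℝ), F p.1 * (p.2.1 ^ m * Real.exp (-p.2.1 ^ 2))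
          ∂(sphereMeasure d).prod (.volumeIoiPow d) := by
        have h := (volume : Measure E).measurePreserving_homeomorphUnitSphereProd.integral_comp
          (Homeomorph.measurableEmbedding _)
          (fun p : USphere d × Set.Ioi (0 : ℝ) => F p.1 * (p.2.1 ^ m * Real.exp (-p.2.1 ^ 2)))
        rw [hdim] at h
        rw [sphereMeasure, ← h]
        congr 1
        ext x
        have hx : ‖x.1‖ ≠ 0 := norm_ne_zero_iff.2 x.2
        simp only [homeomorphUnitSphereProd_apply_snd_coe, homeomorphUnitSphereProd_apply_fst_coe,
          hF, inv_pow]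
        field_simp
    _ = (∫ x : USphere d, F x ∂(sphereMeasure d)) *
          ∫ r : Set.Ioi (0 : ℝ), r.1 ^ m * Real.exp (-r.1 ^ 2) ∂(.volumeIoiPow d) :=
        integral_prod_mul (fun x : USphere d => F x)
          (fun r : Set.Ioi (0 : ℝ) => r.1 ^ m * Real.exp (-r.1 ^ 2))
    _ = _ := by
        rw [mul_comm]
        congr 1
        simp only [Measure.volumeIoiPow, ENNReal.ofReal]
        rw [integral_withDensity_eq_integral_smul (by fun_prop),
          integral_subtype_comap measurableSet_Ioi
            fun r : ℝ => Real.toNNReal (r ^ d) • (r ^ m * Real.exp (-r ^ 2)), radialMoment]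
        refine setIntegral_congr_fun measurableSet_Ioi fun r hr => ?_
        simp only [NNReal.smul_def, Real.coe_toNNReal _ (pow_nonneg (le_of_lt hr) _), smul_eq_mul]
        ring

/-- The Gaussian integral of a polynomial. -/
noncomputable def gaussianIntegral (d : ℕ) (P : MvPolynomial (Fin (d + 1)) ℝ) : ℝ :=
  ∫ x : EuclideanSpace ℝ (Fin (d + 1)), MvPolynomial.aeval (fun i => x i) P * Real.exp (-‖x‖ ^ 2)

theorem monomial_mul_gaussian (d : ℕ) (s : Fin (d + 1) →₀ ℕ) (c : ℝ)
    (x : EuclideanSpace ℝ (Fin (d + 1))) :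
    MvPolynomial.aeval (fun i => x i) (MvPolynomial.monomial s c) * Real.exp (-‖x‖ ^ 2) =
      c * ∏ i, (x i ^ s i * Real.exp (-x i ^ 2)) := by
  rw [MvPolynomial.aeval_monomial, EuclideanSpace.norm_sq_eq, ← Finset.sum_neg_distrib,
    Real.exp_sum, Finset.prod_mul_distrib, Finsupp.prod_fintype _ _ (by simp)]
  simp [mul_assoc]

theorem gaussianIntegral_monomial (d : ℕ) (s : Fin (d + 1) →₀ ℕ) (c : ℝ) :
    gaussianIntegral d (MvPolynomial.monomial s c) =
      c * ∏ i, ∫ x : ℝ, x ^ s i * Real.exp (-x ^ 2) := by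
  simp only [gaussianIntegral, monomial_mul_gaussian, integral_const_mul]
  rw [← integral_fintype_prod_volume_eq_prod (fun i (x : ℝ) => x ^ s i * Real.exp (-x ^ 2)),
    ← (PiLp.volume_preserving_toLp (Fin (d + 1))).integral_comp
      (MeasurableEquiv.toLp 2 _).measurableEmbedding]

theorem integrable_polynomial_mul_gaussian (d : ℕ) (P : MvPolynomial (Fin (d + 1)) ℝ) :
    Integrable fun x : EuclideanSpace ℝ (Fin (d + 1)) =>
      MvPolynomial.aeval (fun i => x i) P * Real.exp (-‖x‖ ^ 2) := by
  induction P using MvPolynomial.induction_on' with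
  | monomial s c =>
    simp only [monomial_mul_gaussian]
    refine Integrable.const_mul ?_ c
    rw [← (PiLp.volume_preserving_toLp (Fin (d + 1))).integrable_comp_emb
      (MeasurableEquiv.toLp 2 _).measurableEmbedding]
    exact Integrable.fintype_prod (f := fun i (x : ℝ) => x ^ s i * Real.exp (-x ^ 2))
      fun i => integrable_pow_mul_exp_neg_sq (s i)
  | add P Q hP hQ =>
    simp only [map_add, add_mul]
    exact hP.add hQ

theorem gaussianIntegral_sum (d : ℕ) {ι : Type*} (s : Finset ι)
    (P : ι → MvPolynomial (Fin (d + 1)) ℝ) :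
    gaussianIntegral d (∑ i ∈ s, P i) = ∑ i ∈ s, gaussianIntegral d (P i) := by
  simp only [gaussianIntegral, map_sum, Finset.sum_mul]
  exact integral_finsetSum _ fun i _ => integrable_polynomial_mul_gaussian d (P i)

theorem polyLaplacian_apply (d : ℕ) (P : MvPolynomial (Fin (d + 1)) ℝ) :
    polyLaplacian d P = ∑ i, MvPolynomial.pderiv i (MvPolynomial.pderiv i P) := by
  simp [polyLaplacian]

theorem gaussianIntegral_pderiv_pderiv_monomial (d : ℕ) (s : Fin (d + 1) →₀ ℕ) (c : ℝ)
    (i : Fin (d + 1)) :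
    gaussianIntegral d (MvPolynomial.pderiv i (MvPolynomial.pderiv i (MvPolynomial.monomial s c))) =
      2 * s i * gaussianIntegral d (MvPolynomial.monomial s c) := by
  classical
  rw [MvPolynomial.pderiv_monomial, MvPolynomial.pderiv_monomial, gaussianIntegral_monomial,
    gaussianIntegral_monomial, ← Finset.mul_prod_erase _ _ (Finset.mem_univ i),
    ← Finset.mul_prod_erase _ _ (Finset.mem_univ i)]
  have h := gaussian_moment_deriv (s i)
  have hp : ∏ j ∈ Finset.univ.erase i, ∫ x : ℝ,
      x ^ ((s - Finsupp.single i 1 - Finsupp.single i 1 : Fin (d + 1) →₀ ℕ) j) * Real.exp (-x ^ 2) =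
      ∏ j ∈ Finset.univ.erase i, ∫ x : ℝ, x ^ s j * Real.exp (-x ^ 2) := by
    refine Finset.prod_congr rfl fun j hj => ?_
    have : i ≠ j := (Finset.ne_of_mem_erase hj).symm
    simp [this]
  rw [hp]
  simp only [Finsupp.coe_tsub, Pi.sub_apply, Finsupp.single_eq_same, Nat.sub_sub]
  norm_num only
  linear_combination (c * ∏ j ∈ Finset.univ.erase i, ∫ x : ℝ, x ^ s j * Real.exp (-x ^ 2)) * h

theorem sum_eq_of_mem_support {d m : ℕ} {P : MvPolynomial (Fin (d + 1)) ℝ}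
    (hP : P.IsHomogeneous m) {s : Fin (d + 1) →₀ ℕ} (hs : s ∈ P.support) : ∑ i, s i = m := by
  have := hP (MvPolynomial.mem_support_iff.1 hs)
  rw [← this, Finsupp.weight_apply, Finsupp.sum_fintype _ _ (by simp)]
  simp

/-- The Gaussian integral of `ΔP` is `2m` times that of `P`, for `P` homogeneous of degree `m`:
the Ornstein-Uhlenbeck form of integration by parts. -/
theorem gaussianIntegral_polyLaplacian (d m : ℕ) {P : MvPolynomial (Fin (d + 1)) ℝ}
    (hP : P.IsHomogeneous m) :
    gaussianIntegral d (polyLaplacian d P) = 2 * m * gaussianIntegral d P := by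
  rw [P.as_sum, map_sum, gaussianIntegral_sum, gaussianIntegral_sum, Finset.mul_sum]
  refine Finset.sum_congr rfl fun s hs => ?_
  rw [polyLaplacian_apply, gaussianIntegral_sum]
  simp only [gaussianIntegral_pderiv_pderiv_monomial]
  rw [← Finset.sum_mul, ← Finset.mul_sum]
  rw [← sum_eq_of_mem_support hP hs]
  push_cast
  rfl

theorem polyRestrict_apply (d : ℕ) (P : MvPolynomial (Fin (d + 1)) ℝ) (x : USphere d) :
    polyRestrict d P x = MvPolynomial.aeval (fun i => x.1 i) P := rfl

theorem aeval_smul_of_isHomogeneous {d m : ℕ} {P : MvPolynomial (Fin (d + 1)) ℝ}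
    (hP : P.IsHomogeneous m) (r : ℝ) (x : EuclideanSpace ℝ (Fin (d + 1))) :
    MvPolynomial.aeval (fun i => (r • x) i) P =
      r ^ m * MvPolynomial.aeval (fun i => x i) P := by
  simp only [MvPolynomial.aeval_def, MvPolynomial.eval₂_eq', PiLp.smul_apply, smul_eq_mul,
    Finset.mul_sum]
  refine Finset.sum_congr rfl fun s hs => ?_
  simp only [mul_pow, Finset.prod_mul_distrib]
  rw [Finset.prod_pow_eq_pow_sum, sum_eq_of_mem_support hP hs]
  ring

theorem gaussianIntegral_of_isHomogeneous {d m : ℕ} {P : MvPolynomial (Fin (d + 1)) ℝ}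
    (hP : P.IsHomogeneous m) :
    gaussianIntegral d P =
      radialMoment (m + d) * ∫ x, polyRestrict d P x ∂(sphereMeasure d) :=
  integral_gaussian_of_homogeneous d m
    (fun x => MvPolynomial.aeval (fun i => x i) P) (aeval_smul_of_isHomogeneous hP)

theorem isHomogeneous_polyLaplacian {d m : ℕ} {P : MvPolynomial (Fin (d + 1)) ℝ}
    (hP : P.IsHomogeneous m) : (polyLaplacian d P).IsHomogeneous (m - 2) := by
  rw [polyLaplacian_apply]
  exact MvPolynomial.IsHomogeneous.sum _ _ _ fun i _ => hP.pderiv.pderiv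

/-- The integral over the sphere of the Laplacian of a homogeneous polynomial. It follows by
comparing the two sides with their Gaussian integrals, the radial moments of which have degrees
`m - 2 + d` and `m + d`. -/
theorem integral_polyLaplacian {d m : ℕ} {P : MvPolynomial (Fin (d + 1)) ℝ}
    (hP : P.IsHomogeneous m) :
    ∫ x, polyRestrict d (polyLaplacian d P) x ∂(sphereMeasure d) =
      (m : ℝ) * (m + d - 1) * ∫ x, polyRestrict d P x ∂(sphereMeasure d) := by
  have h := gaussianIntegral_polyLaplacian d m hP
  rw [gaussianIntegral_of_isHomogeneous hP,
    gaussianIntegral_of_isHomogeneous (isHomogeneous_polyLaplacian hP)] at h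
  have hpos := radialMoment_pos (m - 2 + d)
  -- For `m < 2` the degree `m - 2` is truncated, so these degrees are treated apart.
  rcases Nat.lt_or_ge m 2 with hm | hm
  · interval_cases m
    · have h' : radialMoment d ≠ 0 := (radialMoment_pos d).ne'
      simpa [h'] using h
    · have h0 : polyLaplacian d P = 0 := by
        rw [polyLaplacian_apply]
        refine Finset.sum_eq_zero fun i _ => ?_
        have h1 : (MvPolynomial.pderiv i P).IsHomogeneous 0 := hP.pderiv
        rw [MvPolynomial.totalDegree_eq_zero_iff_eq_C.1
          ((MvPolynomial.totalDegree_zero_iff_isHomogeneous _).2 h1), MvPolynomial.pderiv_C]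
      have h' : radialMoment (1 + d) ≠ 0 := (radialMoment_pos _).ne'
      rw [h0] at h ⊢
      simp only [map_zero, Pi.zero_apply, integral_zero, mul_zero] at h ⊢
      have := (mul_eq_zero.1 (mul_eq_zero.1 h.symm |>.resolve_left (by norm_num))).resolve_left h'
      rw [this, mul_zero]
  · obtain ⟨k, rfl⟩ := Nat.exists_eq_add_of_le' hm
    have e : k + 2 + d = k + d + 2 := by ring
    rw [Nat.add_sub_cancel] at h hpos
    rw [e, radialMoment_add_two] at h
    apply mul_left_cancel₀ hpos.ne'
    rw [h]
    push_cast
    ring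

section

variable {d : ℕ}

/-! ### Zonal multiplication and directional derivatives -/

/-- The linear form `⟨·, y⟩` as a polynomial. -/
noncomputable def linForm {d : ℕ} (y : EuclideanSpace ℝ (Fin (d + 1))) :
    MvPolynomial (Fin (d + 1)) ℝ :=
  ∑ i, MvPolynomial.C (y i) * MvPolynomial.X i

/-- The derivative of polynomials in the direction `y`. -/
noncomputable def dirDeriv {d : ℕ} (y : EuclideanSpace ℝ (Fin (d + 1))) :
    Derivation ℝ (MvPolynomial (Fin (d + 1)) ℝ) (MvPolynomial (Fin (d + 1)) ℝ) :=
  ∑ i, y i • MvPolynomial.pderiv i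


theorem dirDeriv_apply (y : EuclideanSpace ℝ (Fin (d + 1))) (P : MvPolynomial (Fin (d + 1)) ℝ) :
    dirDeriv y P = ∑ i, MvPolynomial.C (y i) * MvPolynomial.pderiv i P := by
  have h : ∀ s : Finset (Fin (d + 1)),
      (∑ i ∈ s, y i • MvPolynomial.pderiv (R := ℝ) i) P =
        ∑ i ∈ s, MvPolynomial.C (y i) * MvPolynomial.pderiv i P := by
    classical
    intro s
    induction s using Finset.induction_on with
    | empty => simp
    | insert a s ha ih =>
      rw [Finset.sum_insert ha, Finset.sum_insert ha, Derivation.add_apply, ih,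
        Derivation.smul_apply, MvPolynomial.smul_eq_C_mul]
  exact h _

theorem pderiv_linForm (y : EuclideanSpace ℝ (Fin (d + 1))) (i : Fin (d + 1)) :
    MvPolynomial.pderiv i (linForm y) = MvPolynomial.C (y i) := by
  classical
  simp [linForm, MvPolynomial.pderiv_X, Pi.single_apply]

theorem aeval_linForm (x y : EuclideanSpace ℝ (Fin (d + 1))) :
    MvPolynomial.aeval (fun i => x i) (linForm y) = inner ℝ x y := by
  simp [linForm, PiLp.inner_apply]

theorem isHomogeneous_linForm (y : EuclideanSpace ℝ (Fin (d + 1))) :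
    (linForm y).IsHomogeneous 1 := by
  refine MvPolynomial.IsHomogeneous.sum _ _ _ fun i _ => ?_
  simpa using (MvPolynomial.isHomogeneous_C _ (y i)).mul (MvPolynomial.isHomogeneous_X ℝ i)

theorem isHomogeneous_dirDeriv {m : ℕ} (y : EuclideanSpace ℝ (Fin (d + 1)))
    {P : MvPolynomial (Fin (d + 1)) ℝ} (hP : P.IsHomogeneous m) :
    (dirDeriv y P).IsHomogeneous (m - 1) := by
  rw [dirDeriv_apply]
  refine MvPolynomial.IsHomogeneous.sum _ _ _ fun i _ => ?_
  simpa using (MvPolynomial.isHomogeneous_C _ (y i)).mul (hP.pderiv (i := i))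

theorem pderiv_pderiv_comm (i j : Fin (d + 1)) (P : MvPolynomial (Fin (d + 1)) ℝ) :
    MvPolynomial.pderiv i (MvPolynomial.pderiv j P) =
      MvPolynomial.pderiv j (MvPolynomial.pderiv i P) := by
  classical
  have h : ⁅MvPolynomial.pderiv (R := ℝ) i, MvPolynomial.pderiv (R := ℝ) j⁆ = 0 := by
    refine MvPolynomial.derivation_ext fun k => ?_
    simp only [Derivation.commutator_apply, MvPolynomial.pderiv_X, Pi.single_apply]
    split_ifs <;> simp
  have := congrArg
    (fun D : Derivation ℝ (MvPolynomial (Fin (d + 1)) ℝ) (MvPolynomial (Fin (d + 1)) ℝ) => D P) h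
  simpa [Derivation.commutator_apply, sub_eq_zero] using this

theorem polyLaplacian_dirDeriv (y : EuclideanSpace ℝ (Fin (d + 1)))
    (P : MvPolynomial (Fin (d + 1)) ℝ) :
    polyLaplacian d (dirDeriv y P) = dirDeriv y (polyLaplacian d P) := by
  simp only [polyLaplacian_apply, dirDeriv_apply, map_sum, MvPolynomial.pderiv_C_mul]
  rw [Finset.sum_comm]
  refine Finset.sum_congr rfl fun i _ => Finset.sum_congr rfl fun j _ => ?_
  rw [pderiv_pderiv_comm i j P, pderiv_pderiv_comm i j]

theorem aeval_dirDeriv_self {m : ℕ} (y : EuclideanSpace ℝ (Fin (d + 1)))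
    {P : MvPolynomial (Fin (d + 1)) ℝ} (hP : P.IsHomogeneous m) :
    MvPolynomial.aeval (fun i => y i) (dirDeriv y P) =
      m * MvPolynomial.aeval (fun i => y i) P := by
  have h := congrArg (MvPolynomial.aeval (fun i => y i)) hP.sum_X_mul_pderiv
  simpa [dirDeriv_apply] using h

theorem polyLaplacian_mul (P Q : MvPolynomial (Fin (d + 1)) ℝ) :
    polyLaplacian d (P * Q) = polyLaplacian d P * Q + P * polyLaplacian d Q +
      2 * ∑ i, MvPolynomial.pderiv i P * MvPolynomial.pderiv i Q := by
  simp only [polyLaplacian_apply, Finset.sum_mul, Finset.mul_sum, ← Finset.sum_add_distrib,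
    MvPolynomial.pderiv_mul, map_add]
  refine Finset.sum_congr rfl fun i _ => ?_
  ring

theorem sum_pderiv_linForm_mul (y : EuclideanSpace ℝ (Fin (d + 1)))
    (P : MvPolynomial (Fin (d + 1)) ℝ) :
    ∑ i, MvPolynomial.pderiv i (linForm y) * MvPolynomial.pderiv i P = dirDeriv y P := by
  simp only [pderiv_linForm, dirDeriv_apply]

theorem polyLaplacian_linForm (y : EuclideanSpace ℝ (Fin (d + 1))) :
    polyLaplacian d (linForm y) = 0 := by
  simp [polyLaplacian_apply, pderiv_linForm]

theorem sum_C_sq {y : EuclideanSpace ℝ (Fin (d + 1))} (hy : ‖y‖ = 1) :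
    ∑ i, MvPolynomial.C (y i) * MvPolynomial.C (σ := Fin (d + 1)) (y i) = 1 := by
  have h := EuclideanSpace.norm_sq_eq y
  rw [hy] at h
  simp only [Real.norm_eq_abs, sq_abs, one_pow] at h
  rw [← MvPolynomial.C_1, h, map_sum]
  simp [sq]

theorem dirDeriv_linForm {y : EuclideanSpace ℝ (Fin (d + 1))} (hy : ‖y‖ = 1) :
    dirDeriv y (linForm y) = 1 := by
  simp only [dirDeriv_apply, pderiv_linForm, sum_C_sq hy]

theorem polyLaplacian_linForm_pow {y : EuclideanSpace ℝ (Fin (d + 1))} (hy : ‖y‖ = 1) (k : ℕ) :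
    polyLaplacian d (linForm y ^ k) =
      MvPolynomial.C ((k : ℝ) * (k - 1 : ℕ)) * linForm y ^ (k - 2) := by
  rw [polyLaplacian_apply]
  simp only [MvPolynomial.pderiv_pow, pderiv_linForm, Derivation.leibniz, MvPolynomial.pderiv_C,
    smul_eq_mul, Derivation.map_natCast, mul_zero, add_zero]
  rw [← one_mul (MvPolynomial.C _ * _), ← sum_C_sq hy, Finset.sum_mul]
  refine Finset.sum_congr rfl fun i _ => ?_
  simp only [map_mul, map_natCast, Nat.sub_sub]
  ring

theorem polyLaplacian_linForm_pow_mul {y : EuclideanSpace ℝ (Fin (d + 1))} (hy : ‖y‖ = 1) (k : ℕ)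
    {P : MvPolynomial (Fin (d + 1)) ℝ} (hP : polyLaplacian d P = 0) :
    polyLaplacian d (linForm y ^ k * P) =
      MvPolynomial.C ((k : ℝ) * (k - 1 : ℕ)) * (linForm y ^ (k - 2) * P) +
        MvPolynomial.C (2 * (k : ℝ)) * (linForm y ^ (k - 1) * dirDeriv y P) := by
  rw [polyLaplacian_mul, hP, polyLaplacian_linForm_pow hy, ← sum_pderiv_linForm_mul]
  simp only [MvPolynomial.pderiv_pow, Finset.mul_sum, map_mul, map_natCast, map_ofNat]
  rw [mul_zero, add_zero, mul_assoc]
  congr 1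
  refine Finset.sum_congr rfl fun i _ => ?_
  ring

/-! ### The Funk-Hecke formula -/

theorem continuous_polyRestrict (P : MvPolynomial (Fin (d + 1)) ℝ) :
    Continuous (polyRestrict d P) := by
  have : polyRestrict d P = fun x : USphere d => MvPolynomial.eval (fun i => x.1 i) P := by
    ext x; rw [polyRestrict_apply, MvPolynomial.aeval_eq_eval]
  rw [this]
  exact (MvPolynomial.continuous_eval P).comp (by fun_prop)

theorem Continuous.integrable_sphereMeasure {F : USphere d → ℝ} (hF : Continuous F) :
    Integrable F (sphereMeasure d) :=
  hF.integrable_of_hasCompactSupport (HasCompactSupport.of_compactSpace F)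

theorem polyRestrict_linForm_pow_mul (y x : USphere d) (k : ℕ)
    (P : MvPolynomial (Fin (d + 1)) ℝ) :
    polyRestrict d (linForm y.1 ^ k * P) x = sphereInner x y ^ k * polyRestrict d P x := by
  simp only [polyRestrict_apply, map_mul, map_pow, aeval_linForm]
  rfl

theorem integral_polyRestrict_add (P Q : MvPolynomial (Fin (d + 1)) ℝ) :
    ∫ x, polyRestrict d (P + Q) x ∂(sphereMeasure d) =
      ∫ x, polyRestrict d P x ∂(sphereMeasure d) + ∫ x, polyRestrict d Q x ∂(sphereMeasure d) := by
  simp only [map_add, Pi.add_apply]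
  exact integral_add (continuous_polyRestrict P).integrable_sphereMeasure
    (continuous_polyRestrict Q).integrable_sphereMeasure

theorem integral_polyRestrict_C_mul (c : ℝ) (P : MvPolynomial (Fin (d + 1)) ℝ) :
    ∫ x, polyRestrict d (MvPolynomial.C c * P) x ∂(sphereMeasure d) =
      c * ∫ x, polyRestrict d P x ∂(sphereMeasure d) := by
  rw [← integral_const_mul]
  simp [polyRestrict_apply]

/-- The recursion for the integrals of `⟨·, y⟩^k P` with `P` harmonic, obtained by integrating
the Laplacian of that polynomial over the sphere. -/
theorem integral_linForm_pow_mul {m : ℕ} (y : USphere d) (k : ℕ)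
    {P : MvPolynomial (Fin (d + 1)) ℝ} (hP : P.IsHomogeneous m) (hP0 : polyLaplacian d P = 0) :
    ((k + m : ℕ) : ℝ) * ((k + m : ℕ) + d - 1) *
        ∫ x, sphereInner x y ^ k * polyRestrict d P x ∂(sphereMeasure d) =
      k * (k - 1 : ℕ) * ∫ x, sphereInner x y ^ (k - 2) * polyRestrict d P x ∂(sphereMeasure d) +
      2 * k * ∫ x, sphereInner x y ^ (k - 1) * polyRestrict d (dirDeriv y.1 P) x
        ∂(sphereMeasure d) := by
  have hy : ‖y.1‖ = 1 := by simp
  have hh : (linForm y.1 ^ k * P).IsHomogeneous (k + m) := by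
    simpa using ((isHomogeneous_linForm y.1).pow k).mul hP
  have h := integral_polyLaplacian hh
  rw [polyLaplacian_linForm_pow_mul hy k hP0, integral_polyRestrict_add,
    integral_polyRestrict_C_mul, integral_polyRestrict_C_mul] at h
  simp only [polyRestrict_linForm_pow_mul] at h
  exact h.symm

/-- The Funk-Hecke formula for monomials, with an eigenvalue that depends on the exponent and on
the degree only: both terms of the recursion are multiples of `P(y)`, the second by Euler's
identity. -/
theorem exists_integral_pow_mul_harmonic (hd : 1 ≤ d) (k m : ℕ) :
    ∃ a : ℝ, ∀ P : MvPolynomial (Fin (d + 1)) ℝ, P.IsHomogeneous m → polyLaplacian d P = 0 →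
      ∀ y : USphere d, ∫ x, sphereInner x y ^ k * polyRestrict d P x ∂(sphereMeasure d) =
        a * polyRestrict d P y := by
  have hd' : (1 : ℝ) ≤ d := by exact_mod_cast hd
  induction k using Nat.strong_induction_on generalizing m with
  | _ k ih =>
    rcases Nat.eq_zero_or_pos (k + m) with h0 | h0
    · obtain ⟨rfl, rfl⟩ : k = 0 ∧ m = 0 := by omega
      refine ⟨(sphereMeasure d).real Set.univ, fun P hP _ y => ?_⟩
      rw [MvPolynomial.totalDegree_eq_zero_iff_eq_C.1
        ((MvPolynomial.totalDegree_zero_iff_isHomogeneous _).2 hP)]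
      simp [polyRestrict_apply]
    have h0' : (1 : ℝ) ≤ ((k + m : ℕ) : ℝ) := by exact_mod_cast h0
    have hne : ((k + m : ℕ) : ℝ) * ((k + m : ℕ) + d - 1) ≠ 0 :=
      (mul_pos (by linarith) (by linarith)).ne'
    rcases Nat.eq_zero_or_pos k with rfl | hk
    · refine ⟨0, fun P hP hP0 y => ?_⟩
      have h := integral_linForm_pow_mul y 0 hP hP0
      simp only [Nat.cast_zero, zero_mul, mul_zero, add_zero] at h
      rw [zero_mul]
      exact (mul_eq_zero.1 h).resolve_left hne
    obtain ⟨b, hb⟩ := ih (k - 1) (by omega) (m - 1)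
    have hc : ∃ c : ℝ, ∀ P : MvPolynomial (Fin (d + 1)) ℝ, P.IsHomogeneous m →
        polyLaplacian d P = 0 → ∀ y : USphere d,
        k * (k - 1 : ℕ) * ∫ x, sphereInner x y ^ (k - 2) * polyRestrict d P x ∂(sphereMeasure d) =
          c * polyRestrict d P y := by
      obtain ⟨c, hc⟩ := ih (k - 2) (by omega) m
      exact ⟨k * (k - 1 : ℕ) * c, fun P hP hP0 y => by rw [hc P hP hP0 y, ← mul_assoc]⟩
    obtain ⟨c, hc⟩ := hc
    refine ⟨(c + 2 * k * b * m) / (((k + m : ℕ) : ℝ) * ((k + m : ℕ) + d - 1)),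
      fun P hP hP0 y => ?_⟩
    have h := integral_linForm_pow_mul y k hP hP0
    rw [hc P hP hP0 y, hb _ (isHomogeneous_dirDeriv y.1 hP)
      (by rw [polyLaplacian_dirDeriv, hP0, map_zero]) y] at h
    have he : polyRestrict d (dirDeriv y.1 P) y = m * polyRestrict d P y :=
      aeval_dirDeriv_self y.1 hP
    rw [he] at h
    apply mul_left_cancel₀ hne
    rw [h, ← mul_assoc (((k + m : ℕ) : ℝ) * _), mul_div_cancel₀ _ hne]
    ring

theorem continuous_sphereInner : Continuous fun p : USphere d × USphere d =>
    sphereInner p.1 p.2 := by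
  unfold sphereInner
  fun_prop

theorem continuous_of_mem_sphericalHarmonics {ℓ : ℕ} {Y : USphere d → ℝ}
    (hY : Y ∈ sphericalHarmonics d ℓ) : Continuous Y := by
  obtain ⟨P, -, rfl⟩ := Submodule.mem_map.1 hY
  exact continuous_polyRestrict P

theorem Continuous.eval_sphereInner (f : ℝ[X]) {X : Type*} [TopologicalSpace X]
    {u v : X → USphere d} (hu : Continuous u) (hv : Continuous v) :
    Continuous fun x => f.eval (sphereInner (u x) (v x)) :=
  f.continuous.comp (continuous_sphereInner.comp (hu.prodMk hv))

/-- The Funk-Hecke formula, with an unspecified eigenvalue. -/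
theorem exists_funkHecke (hd : 1 ≤ d) (ℓ : ℕ) (f : ℝ[X]) :
    ∃ a : ℝ, ∀ Y ∈ sphericalHarmonics d ℓ, ∀ y : USphere d,
      ∫ x, f.eval (sphereInner x y) * Y x ∂(sphereMeasure d) = a * Y y := by
  induction f using Polynomial.induction_on' with
  | add f g hf hg =>
    obtain ⟨a, ha⟩ := hf
    obtain ⟨b, hb⟩ := hg
    refine ⟨a + b, fun Y hY y => ?_⟩
    have hc := continuous_of_mem_sphericalHarmonics hY
    simp only [Polynomial.eval_add, add_mul]
    rw [integral_add, ha Y hY y, hb Y hY y]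
    all_goals exact ((Continuous.eval_sphereInner _ continuous_id continuous_const).mul
      hc).integrable_sphereMeasure
  | monomial k c =>
    obtain ⟨a, ha⟩ := exists_integral_pow_mul_harmonic hd k ℓ
    refine ⟨c * a, fun Y hY y => ?_⟩
    obtain ⟨P, ⟨hP, hP0⟩, rfl⟩ := Submodule.mem_map.1 hY
    simp only [Polynomial.eval_monomial, mul_assoc, integral_const_mul]
    rw [ha P ((MvPolynomial.mem_homogeneousSubmodule _ _).1 hP) hP0 y]

/-! ### Zonal harmonics -/

/-- The polynomial `|x|²`. -/
noncomputable def normSqPoly (d : ℕ) : MvPolynomial (Fin (d + 1)) ℝ :=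
  ∑ i, MvPolynomial.X i ^ 2

theorem pderiv_normSqPoly (i : Fin (d + 1)) :
    MvPolynomial.pderiv i (normSqPoly d) = 2 * MvPolynomial.X i := by
  classical
  simp [normSqPoly, MvPolynomial.pderiv_X, Pi.single_apply]

theorem isHomogeneous_normSqPoly (d : ℕ) : (normSqPoly d).IsHomogeneous 2 :=
  MvPolynomial.IsHomogeneous.sum _ _ _ fun i _ => by
    simpa using (MvPolynomial.isHomogeneous_X ℝ i).pow 2

theorem polyRestrict_normSqPoly (x : USphere d) : polyRestrict d (normSqPoly d) x = 1 := by
  have h := EuclideanSpace.norm_sq_eq x.1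
  have hx : ‖x.1‖ = 1 := by simp
  rw [hx] at h
  simp only [Real.norm_eq_abs, sq_abs, one_pow] at h
  simpa [polyRestrict_apply, normSqPoly] using h.symm

theorem dirDeriv_normSqPoly (y : EuclideanSpace ℝ (Fin (d + 1))) :
    dirDeriv y (normSqPoly d) = 2 * linForm y := by
  simp only [dirDeriv_apply, pderiv_normSqPoly, linForm, Finset.mul_sum]
  exact Finset.sum_congr rfl fun i _ => by ring

theorem polyLaplacian_normSqPoly_mul {m : ℕ} {P : MvPolynomial (Fin (d + 1)) ℝ}
    (hP : P.IsHomogeneous m) (hP0 : polyLaplacian d P = 0) :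
    polyLaplacian d (normSqPoly d * P) = MvPolynomial.C (2 * (2 * (m : ℝ) + d + 1)) * P := by
  have h1 : polyLaplacian d (normSqPoly d) = MvPolynomial.C (2 * ((d : ℝ) + 1)) := by
    have h2 : (2 : MvPolynomial (Fin (d + 1)) ℝ) = MvPolynomial.C 2 := (map_ofNat _ 2).symm
    simp [polyLaplacian_apply, pderiv_normSqPoly, h2, mul_comm]
  have h3 : ∑ i, MvPolynomial.pderiv i (normSqPoly d) * MvPolynomial.pderiv i P =
      2 * (MvPolynomial.C (m : ℝ) * P) := by
    have := hP.sum_X_mul_pderiv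
    rw [map_natCast, ← nsmul_eq_mul, ← this, Finset.mul_sum]
    refine Finset.sum_congr rfl fun i _ => ?_
    rw [pderiv_normSqPoly, mul_assoc]
  rw [polyLaplacian_mul, h1, h3, hP0]
  simp only [map_mul, map_add, map_ofNat, map_natCast, map_one]
  ring

/-- The homogeneous extension `|x|^ℓ G_{ℓ;d}(⟨x, y⟩ / |x|)` of the zonal harmonic of degree `ℓ`
with pole `y`, through the homogenised three-term recurrence. -/
noncomputable def zonalPoly (y : EuclideanSpace ℝ (Fin (d + 1))) :
    ℕ → MvPolynomial (Fin (d + 1)) ℝ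
  | 0 => 1
  | 1 => linForm y
  | ℓ + 2 =>
      MvPolynomial.C (((ℓ : ℝ) + d)⁻¹) *
        (MvPolynomial.C (2 * (ℓ : ℝ) + d + 1) * (linForm y * zonalPoly y (ℓ + 1))
          - MvPolynomial.C ((ℓ : ℝ) + 1) * (normSqPoly d * zonalPoly y ℓ))

theorem isHomogeneous_zonalPoly (y : EuclideanSpace ℝ (Fin (d + 1))) :
    ∀ ℓ, (zonalPoly y ℓ).IsHomogeneous ℓ
  | 0 => MvPolynomial.isHomogeneous_one _ _
  | 1 => isHomogeneous_linForm y
  | ℓ + 2 => by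
    have h1 : (linForm y * zonalPoly y (ℓ + 1)).IsHomogeneous (ℓ + 2) := by
      have := (isHomogeneous_linForm y).mul (isHomogeneous_zonalPoly y (ℓ + 1))
      rwa [show 1 + (ℓ + 1) = ℓ + 2 by ring] at this
    have h2 : (normSqPoly d * zonalPoly y ℓ).IsHomogeneous (ℓ + 2) := by
      have := (isHomogeneous_normSqPoly d).mul (isHomogeneous_zonalPoly y ℓ)
      rwa [show 2 + ℓ = ℓ + 2 by ring] at this
    rw [zonalPoly]
    exact ((h1.C_mul _).sub (h2.C_mul _)).C_mul _

theorem polyRestrict_zonalPoly (x y : USphere d) :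
    ∀ ℓ, polyRestrict d (zonalPoly y.1 ℓ) x = gegK d ℓ x y
  | 0 => by simp [polyRestrict_apply, zonalPoly, gegK, gegenbauer]
  | 1 => by
    rw [polyRestrict_apply, zonalPoly, aeval_linForm]
    simp [gegK, gegenbauer, sphereInner]
  | ℓ + 2 => by
    have h1 := polyRestrict_zonalPoly x y (ℓ + 1)
    have h0 := polyRestrict_zonalPoly x y ℓ
    have hN := polyRestrict_normSqPoly x
    rw [polyRestrict_apply] at h1 h0 hN ⊢
    simp only [zonalPoly, map_mul, map_sub, h1, h0, hN, aeval_linForm, MvPolynomial.algHom_C,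
      Algebra.algebraMap_self_apply, gegK, gegenbauer, Polynomial.eval_mul, Polynomial.eval_sub,
      Polynomial.eval_C, Polynomial.eval_X]
    simp only [sphereInner]
    ring

theorem dirDeriv_C_mul (y : EuclideanSpace ℝ (Fin (d + 1))) (c : ℝ)
    (P : MvPolynomial (Fin (d + 1)) ℝ) :
    dirDeriv y (MvPolynomial.C c * P) = MvPolynomial.C c * dirDeriv y P := by
  rw [← MvPolynomial.smul_eq_C_mul, Derivation.map_smul, MvPolynomial.smul_eq_C_mul]

theorem C_inv_mul_cancel {c : ℝ} (hc : c ≠ 0) (P : MvPolynomial (Fin (d + 1)) ℝ) :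
    MvPolynomial.C c * (MvPolynomial.C c⁻¹ * P) = P := by
  rw [← mul_assoc, ← map_mul, mul_inv_cancel₀ hc, map_one, one_mul]

/-- The zonal polynomials form an Appell sequence for the derivative along their pole. -/
theorem dirDeriv_zonalPoly (hd : 1 ≤ d) {y : EuclideanSpace ℝ (Fin (d + 1))} (hy : ‖y‖ = 1) :
    ∀ ℓ : ℕ, dirDeriv y (zonalPoly y (ℓ + 1)) = MvPolynomial.C ((ℓ : ℝ) + 1) * zonalPoly y ℓ
  | 0 => by simp [zonalPoly, dirDeriv_linForm hy]
  | 1 => by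
    have hne : ((0 : ℕ) : ℝ) + d ≠ 0 := by positivity
    rw [show 1 + 1 = 0 + 2 from rfl, zonalPoly.eq_3, dirDeriv_C_mul, map_sub, dirDeriv_C_mul, dirDeriv_C_mul, Derivation.leibniz,
      Derivation.leibniz, dirDeriv_normSqPoly, zonalPoly, zonalPoly, dirDeriv_linForm hy,
      Derivation.map_one_eq_zero]
    apply mul_left_cancel₀ (MvPolynomial.C_ne_zero.2 hne)
    rw [C_inv_mul_cancel hne]
    simp only [smul_eq_mul, map_mul, map_add, map_ofNat, map_natCast, map_one, Nat.cast_zero,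
      Nat.cast_one]
    ring
  | ℓ + 2 => by
    have hne : ((ℓ + 1 : ℕ) : ℝ) + d ≠ 0 := by positivity
    have hne' : (ℓ : ℝ) + d ≠ 0 := by positivity
    have h1 := dirDeriv_zonalPoly hd hy (ℓ + 1)
    have h0 := dirDeriv_zonalPoly hd hy ℓ
    have hr : MvPolynomial.C ((ℓ : ℝ) + d) * zonalPoly y (ℓ + 2) =
        MvPolynomial.C (2 * (ℓ : ℝ) + d + 1) * (linForm y * zonalPoly y (ℓ + 1))
          - MvPolynomial.C ((ℓ : ℝ) + 1) * (normSqPoly d * zonalPoly y ℓ) := by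
      rw [zonalPoly, C_inv_mul_cancel hne']
    rw [zonalPoly, dirDeriv_C_mul, map_sub, dirDeriv_C_mul, dirDeriv_C_mul, Derivation.leibniz,
      Derivation.leibniz, dirDeriv_normSqPoly, h1, h0, dirDeriv_linForm hy]
    apply mul_left_cancel₀ (MvPolynomial.C_ne_zero.2 hne)
    rw [C_inv_mul_cancel hne]
    simp only [smul_eq_mul, map_mul, map_add, map_ofNat, map_natCast, map_one, Nat.cast_add,
      Nat.cast_one, Nat.cast_ofNat] at hr ⊢
    linear_combination (-(ℓ : MvPolynomial (Fin (d + 1)) ℝ) - 2) * hr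

theorem polyLaplacian_C_mul (c : ℝ) (P : MvPolynomial (Fin (d + 1)) ℝ) :
    polyLaplacian d (MvPolynomial.C c * P) = MvPolynomial.C c * polyLaplacian d P := by
  rw [← MvPolynomial.smul_eq_C_mul, map_smul, MvPolynomial.smul_eq_C_mul]

theorem polyLaplacian_zonalPoly (hd : 1 ≤ d) {y : EuclideanSpace ℝ (Fin (d + 1))} (hy : ‖y‖ = 1) :
    ∀ ℓ : ℕ, polyLaplacian d (zonalPoly y ℓ) = 0
  | 0 => by simp [zonalPoly, polyLaplacian_apply]
  | 1 => polyLaplacian_linForm y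
  | ℓ + 2 => by
    rw [zonalPoly, polyLaplacian_C_mul, map_sub, polyLaplacian_C_mul, polyLaplacian_C_mul,
      polyLaplacian_normSqPoly_mul (isHomogeneous_zonalPoly y ℓ) (polyLaplacian_zonalPoly hd hy ℓ),
      polyLaplacian_mul, polyLaplacian_linForm, polyLaplacian_zonalPoly hd hy (ℓ + 1),
      sum_pderiv_linForm_mul, dirDeriv_zonalPoly hd hy]
    simp only [map_mul, map_add, map_ofNat, map_natCast, map_one]
    ring

theorem gegK_mem_sphericalHarmonics (hd : 1 ≤ d) (ℓ : ℕ) (y : USphere d) :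
    (fun x => gegK d ℓ x y) ∈ sphericalHarmonics d ℓ := by
  refine Submodule.mem_map.2 ⟨zonalPoly y.1 ℓ, ⟨?_, ?_⟩, ?_⟩
  · exact (MvPolynomial.mem_homogeneousSubmodule _ _).2 (isHomogeneous_zonalPoly y.1 ℓ)
  · exact polyLaplacian_zonalPoly hd (by simp) ℓ
  · exact funext fun x => polyRestrict_zonalPoly x y ℓ

/-! ### The Funk-Hecke eigenvalue -/

theorem sphereInner_self (x : USphere d) : sphereInner x x = 1 := by
  simp [sphereInner]

theorem sphereInner_comm (x y : USphere d) : sphereInner x y = sphereInner y x :=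
  real_inner_comm _ _

theorem gegK_comm (ℓ : ℕ) (x y : USphere d) : gegK d ℓ x y = gegK d ℓ y x := by
  rw [gegK, sphereInner_comm, gegK]

theorem gegK_self (hd : 1 ≤ d) (ℓ : ℕ) (x : USphere d) : gegK d ℓ x x = 1 := by
  rw [gegK, sphereInner_self, gegenbauer_eval_one d hd]

@[fun_prop]
theorem Continuous.gegK (ℓ : ℕ) {X : Type*} [TopologicalSpace X]
    {u v : X → USphere d} (hu : Continuous u) (hv : Continuous v) :
    Continuous fun x => gegK d ℓ (u x) (v x) :=
  Continuous.eval_sphereInner _ hu hv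

instance (d : ℕ) : Nonempty (USphere d) :=
  ⟨⟨EuclideanSpace.single 0 1, by simp⟩⟩

/-- The eigenvalue on `sphericalHarmonics d ℓ` of the kernel `G_{ℓ;d}^p`, namely
`∫ G_{ℓ;d}(⟨x, y⟩)^(p+1) dx`. This does not depend on `y`; an arbitrary one is chosen. -/
noncomputable def gegEigen (d ℓ p : ℕ) : ℝ :=
  ∫ x, gegK d ℓ x (Classical.arbitrary (USphere d)) ^ (p + 1) ∂(sphereMeasure d)

/-- The Funk-Hecke formula for the powers of the Gegenbauer kernel. The eigenvalue is found by
applying the general formula to the zonal harmonic at its own pole. -/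
theorem integral_gegK_pow_mul (hd : 1 ≤ d) (ℓ p : ℕ) {Y : USphere d → ℝ}
    (hY : Y ∈ sphericalHarmonics d ℓ) (y : USphere d) :
    ∫ x, gegK d ℓ x y ^ p * Y x ∂(sphereMeasure d) = gegEigen d ℓ p * Y y := by
  obtain ⟨a, ha⟩ := exists_funkHecke hd ℓ (gegenbauer d ℓ ^ p)
  simp only [Polynomial.eval_pow] at ha
  have h0 := ha _ (gegK_mem_sphericalHarmonics hd ℓ (Classical.arbitrary _))
    (Classical.arbitrary (USphere d))
  rw [gegK_self hd, mul_one] at h0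
  have : gegEigen d ℓ p = a := by
    rw [← h0, gegEigen]
    simp only [pow_succ, gegK]
  rw [this]
  exact ha Y hY y

theorem integral_gegK_pow_succ (hd : 1 ≤ d) (ℓ p : ℕ) (y : USphere d) :
    ∫ x, gegK d ℓ x y ^ (p + 1) ∂(sphereMeasure d) = gegEigen d ℓ p := by
  have h := integral_gegK_pow_mul hd ℓ p (gegK_mem_sphericalHarmonics hd ℓ y) y
  simpa [← pow_succ, gegK_self hd] using h

theorem sphereArea_pos (d : ℕ) : 0 < sphereArea d := by
  rw [sphereArea, sphereMeasure, measureReal_def]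
  exact ENNReal.toReal_pos (by
    rw [Ne, Measure.measure_univ_eq_zero]; exact Measure.toSphere_ne_zero _) (measure_ne_top _ _)

theorem IsHarmonicONB.mem {ℓ : ℕ} {Y : Fin (harmDim d ℓ) → USphere d → ℝ}
    (hY : IsHarmonicONB d ℓ Y) (m : Fin (harmDim d ℓ)) : Y m ∈ sphericalHarmonics d ℓ := by
  rw [← hY.span_eq]
  exact Submodule.subset_span ⟨m, rfl⟩

theorem IsHarmonicONB.continuous {ℓ : ℕ} {Y : Fin (harmDim d ℓ) → USphere d → ℝ}
    (hY : IsHarmonicONB d ℓ Y) (m : Fin (harmDim d ℓ)) : Continuous (Y m) :=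
  continuous_of_mem_sphericalHarmonics (hY.mem m)

/-- Expansion of the zonal harmonic with pole `y` in the orthonormal basis. -/
theorem gegK_eq_gegEigen_mul_sum (hd : 1 ≤ d) {ℓ : ℕ} {Y : Fin (harmDim d ℓ) → USphere d → ℝ}
    (hY : IsHarmonicONB d ℓ Y) (x y : USphere d) :
    gegK d ℓ x y = gegEigen d ℓ 1 * ∑ m, Y m x * Y m y := by
  have hcont := hY.continuous
  have hg := gegK_mem_sphericalHarmonics hd ℓ y
  rw [← hY.span_eq] at hg
  obtain ⟨c, hc⟩ := (Submodule.mem_span_range_iff_exists_fun ℝ).1 hg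
  have hc' : ∀ z, gegK d ℓ z y = ∑ m, c m * Y m z := fun z => by
    rw [← congrFun hc z]; simp
  have hcoef : ∀ m, c m = gegEigen d ℓ 1 * Y m y := fun m => by
    rw [← integral_gegK_pow_mul hd ℓ 1 (hY.mem m) y]
    simp only [pow_one, hc', Finset.sum_mul]
    rw [integral_finsetSum _ fun i _ => by
      exact ((continuous_const.mul (hcont i)).mul (hcont m)).integrable_sphereMeasure]
    simp [mul_assoc, integral_const_mul, hY.orthonormal]
  rw [hc', Finset.mul_sum]
  refine Finset.sum_congr rfl fun m _ => ?_
  rw [hcoef]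
  ring

/-- The eigenvalue `∫ G_{ℓ;d}(⟨x, y⟩)² dx` is `μ_d / n_{ℓ;d}`: integrate the addition formula
along the diagonal. -/
theorem gegEigen_one_mul_harmDim (hd : 1 ≤ d) {ℓ : ℕ} {Y : Fin (harmDim d ℓ) → USphere d → ℝ}
    (hY : IsHarmonicONB d ℓ Y) : gegEigen d ℓ 1 * harmDim d ℓ = sphereArea d := by
  have hcont := hY.continuous
  have h : ∫ x, gegK d ℓ x x ∂(sphereMeasure d) =
      ∫ x, gegEigen d ℓ 1 * ∑ m, Y m x * Y m x ∂(sphereMeasure d) := by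
    congr 1; ext x; exact gegK_eq_gegEigen_mul_sum hd hY x x
  simp only [gegK_self hd] at h
  rw [integral_const_mul, integral_finsetSum _ fun i _ => by
    exact ((hcont i).mul (hcont i)).integrable_sphereMeasure] at h
  simp only [hY.orthonormal, if_true] at h
  simpa [sphereArea] using h.symm

/-- The addition formula for hyperspherical harmonics. -/
theorem sum_harmonic_mul_harmonic (hd : 1 ≤ d) {ℓ : ℕ} {Y : Fin (harmDim d ℓ) → USphere d → ℝ}
    (hY : IsHarmonicONB d ℓ Y) (x y : USphere d) :
    ∑ m, Y m x * Y m y = harmDim d ℓ / sphereArea d * gegK d ℓ x y := by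
  have h := gegEigen_one_mul_harmDim hd hY
  have hpos := sphereArea_pos d
  rw [gegK_eq_gegEigen_mul_sum hd hY, ← h]
  have h1 : gegEigen d ℓ 1 ≠ 0 := fun h0 => by rw [h0, zero_mul] at h; exact hpos.ne h
  have h2 : (harmDim d ℓ : ℝ) ≠ 0 := fun h0 => by rw [h0, mul_zero] at h; exact hpos.ne h
  field_simp

/-! ### Zonal integrals in one variable -/

/-- The total area, from the Gaussian integral of the constant polynomial `1`. -/
theorem sqrt_pi_pow_eq_radialMoment_mul_sphereArea (d : ℕ) :
    Real.sqrt Real.pi ^ (d + 1) = radialMoment d * sphereArea d := by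
  have h1 : gaussianIntegral d 1 = Real.sqrt Real.pi ^ (d + 1) := by
    have hg : ∫ x : ℝ, Real.exp (-x ^ 2) = Real.sqrt Real.pi := by simpa using integral_gaussian 1
    have := gaussianIntegral_monomial d 0 1
    simpa [hg] using this
  have h2 := gaussianIntegral_of_isHomogeneous (MvPolynomial.isHomogeneous_one (Fin (d + 1)) ℝ)
  rw [← h1, h2]
  simp [polyRestrict_apply, sphereArea]

theorem sqrt_pi_mul_radialMoment :
    ∀ d : ℕ, Real.sqrt Real.pi * radialMoment d =
      radialMoment (d + 1) * ∫ θ in (0 : ℝ)..Real.pi, Real.sin θ ^ d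
  | 0 => by
    have h : Real.sqrt Real.pi * Real.sqrt Real.pi = Real.pi := Real.mul_self_sqrt Real.pi_pos.le
    rw [radialMoment_eq, radialMoment_eq]
    simp only [Nat.cast_zero, zero_add, Real.Gamma_one_half_eq, pow_zero, Nat.cast_one,
      intervalIntegral.integral_const]
    norm_num
    linear_combination (1 / 2) * h
  | 1 => by
    rw [radialMoment_add_two 0, radialMoment_eq, radialMoment_eq]
    norm_num [Real.Gamma_one_half_eq]
    ring
  | d + 2 => by
    have h := sqrt_pi_mul_radialMoment d
    rw [radialMoment_add_two, show d + 2 + 1 = d + 1 + 2 by ring, radialMoment_add_two,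
      integral_sin_pow]
    have hne : (d : ℝ) + 2 ≠ 0 := by positivity
    simp only [Real.sin_zero, Real.sin_pi]
    push_cast
    field_simp
    simp only [ne_eq, Nat.add_eq_zero_iff, one_ne_zero, and_false, not_false_eq_true, zero_pow]
    linear_combination (d + 1) * (d + 2) * h

theorem sphereArea_succ (d : ℕ) :
    sphereArea (d + 1) = sphereArea d * ∫ θ in (0 : ℝ)..Real.pi, Real.sin θ ^ d := by
  have h1 := sqrt_pi_pow_eq_radialMoment_mul_sphereArea d
  have h2 := sqrt_pi_pow_eq_radialMoment_mul_sphereArea (d + 1)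
  rw [pow_succ, h1] at h2
  have h3 := sqrt_pi_mul_radialMoment d
  have hp := (radialMoment_pos (d + 1)).ne'
  apply mul_left_cancel₀ hp
  linear_combination -h2 + sphereArea d * h3

theorem integral_cos_pow_mul_sin_pow_add_two (k e : ℕ) :
    ((k : ℝ) + 2 + e) * ∫ θ in (0 : ℝ)..Real.pi, Real.cos θ ^ (k + 2) * Real.sin θ ^ e =
      ((k : ℝ) + 1) * ∫ θ in (0 : ℝ)..Real.pi, Real.cos θ ^ k * Real.sin θ ^ e := by
  have h := intervalIntegral.integral_eq_sub_of_hasDerivAt (a := 0) (b := Real.pi)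
    (f := fun θ => Real.cos θ ^ (k + 1) * Real.sin θ ^ (e + 1))
    (f' := fun θ => ((k : ℝ) + 2 + e) * (Real.cos θ ^ (k + 2) * Real.sin θ ^ e) -
      ((k : ℝ) + 1) * (Real.cos θ ^ k * Real.sin θ ^ e))
    (fun θ _ => by
      refine (((Real.hasDerivAt_cos θ).pow (k + 1)).mul
        ((Real.hasDerivAt_sin θ).pow (e + 1))).congr_deriv ?_
      have hs : Real.sin θ ^ 2 = 1 - Real.cos θ ^ 2 := by
        linear_combination Real.sin_sq_add_cos_sq θ
      simp only [Nat.add_sub_cancel, Pi.pow_apply]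
      push_cast
      linear_combination (-(k : ℝ) - 1) * Real.cos θ ^ k * Real.sin θ ^ e * hs)
    (Continuous.intervalIntegrable (by fun_prop) _ _)
  rw [intervalIntegral.integral_sub (Continuous.intervalIntegrable (by fun_prop) _ _)
    (Continuous.intervalIntegrable (by fun_prop) _ _), intervalIntegral.integral_const_mul,
    intervalIntegral.integral_const_mul] at h
  simp only [Real.sin_pi, Real.sin_zero, ne_eq, Nat.add_eq_zero_iff, one_ne_zero, and_false,
    not_false_eq_true, zero_pow, mul_zero, sub_zero] at h
  linarith

theorem integral_sphereInner_pow_add_two (y : USphere d) (k : ℕ) :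
    ((k : ℝ) + 1 + d) * ∫ x, sphereInner x y ^ (k + 2) ∂(sphereMeasure d) =
      ((k : ℝ) + 1) * ∫ x, sphereInner x y ^ k ∂(sphereMeasure d) := by
  have h := integral_linForm_pow_mul y (k + 2) (MvPolynomial.isHomogeneous_one _ _)
    (by simp [polyLaplacian_apply])
  simp only [Derivation.map_one_eq_zero, map_zero, mul_zero, integral_zero,
    add_zero, polyRestrict_apply, map_one, mul_one, Nat.add_sub_cancel] at h
  have hne : (k : ℝ) + 2 ≠ 0 := by positivity
  apply mul_left_cancel₀ hne
  push_cast at h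
  linear_combination h

/-- The zonal moments of the sphere: both sides satisfy the same two-step recursion in `k`. -/
theorem integral_sphereInner_pow (e : ℕ) (y : USphere (e + 1)) :
    ∀ k : ℕ, ∫ x, sphereInner x y ^ k ∂(sphereMeasure (e + 1)) =
      sphereArea e * ∫ θ in (0 : ℝ)..Real.pi, Real.cos θ ^ k * Real.sin θ ^ e
  | 0 => by simpa [sphereArea] using sphereArea_succ e
  | 1 => by
    have h := integral_linForm_pow_mul y 1 (MvPolynomial.isHomogeneous_one _ _)
      (by simp [polyLaplacian_apply])
    simp only [Derivation.map_one_eq_zero, map_zero, mul_zero, integral_zero,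
      add_zero, polyRestrict_apply, map_one, mul_one, Nat.sub_self, Nat.cast_zero, zero_mul,
      mul_eq_zero] at h
    have hne : (e : ℝ) + 1 ≠ 0 := by positivity
    have h1 : ∫ x, sphereInner x y ^ 1 ∂(sphereMeasure (e + 1)) = 0 := by
      refine h.resolve_left ?_
      push_cast
      simpa using hne
    have h2 := intervalIntegral.integral_eq_sub_of_hasDerivAt (a := 0) (b := Real.pi)
      (f := fun θ => Real.sin θ ^ (e + 1))
      (f' := fun θ => ((e : ℝ) + 1) * (Real.cos θ ^ 1 * Real.sin θ ^ e))
      (fun θ _ => by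
        refine ((Real.hasDerivAt_sin θ).pow (e + 1)).congr_deriv ?_
        simp only [Nat.add_sub_cancel]
        push_cast
        ring)
      (Continuous.intervalIntegrable (by fun_prop) _ _)
    rw [intervalIntegral.integral_const_mul] at h2
    simp only [Real.sin_pi, Real.sin_zero, sub_self] at h2
    rw [h1, (mul_eq_zero.1 h2).resolve_left hne, mul_zero]
  | k + 2 => by
    have h := integral_sphereInner_pow e y k
    have h1 := integral_sphereInner_pow_add_two y k
    have h2 := integral_cos_pow_mul_sin_pow_add_two k e
    have hne : (k : ℝ) + 2 + e ≠ 0 := by positivity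
    apply mul_left_cancel₀ hne
    push_cast at h1
    linear_combination h1 + (k + 1) * h - sphereArea e * h2

/-- Integration of a zonal polynomial function, in the angle to the pole. -/
theorem integral_eval_sphereInner (e : ℕ) (y : USphere (e + 1)) (f : ℝ[X]) :
    ∫ x, f.eval (sphereInner x y) ∂(sphereMeasure (e + 1)) =
      sphereArea e * ∫ θ in (0 : ℝ)..Real.pi, f.eval (Real.cos θ) * Real.sin θ ^ e := by
  induction f using Polynomial.induction_on' with
  | add f g hf hg =>
    simp only [Polynomial.eval_add, add_mul]
    rw [integral_add, intervalIntegral.integral_add, hf, hg, mul_add]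
    any_goals exact (Continuous.eval_sphereInner _ continuous_id
      continuous_const).integrable_sphereMeasure
    all_goals exact ((Polynomial.continuous _).comp Real.continuous_cos |>.mul
      (Real.continuous_sin.pow e)).intervalIntegrable _ _
  | monomial k c =>
    simp only [Polynomial.eval_monomial, mul_assoc, integral_const_mul,
      intervalIntegral.integral_const_mul, integral_sphereInner_pow]
    ring

/-- The substitution `t = cos θ`. -/
theorem integral_mul_sqrt_one_sub_sq_pow (f : ℝ[X]) (n : ℕ) :
    ∫ t in (-1 : ℝ)..1, f.eval t * Real.sqrt (1 - t ^ 2) ^ n =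
      ∫ θ in (0 : ℝ)..Real.pi, f.eval (Real.cos θ) * Real.sin θ ^ (n + 1) := by
  have h := intervalIntegral.integral_comp_mul_deriv (a := 0) (b := Real.pi)
    (f := Real.cos) (f' := fun θ => -Real.sin θ)
    (g := fun t => f.eval t * Real.sqrt (1 - t ^ 2) ^ n)
    (fun θ _ => Real.hasDerivAt_cos θ) (by fun_prop)
    (f.continuous.mul (by fun_prop))
  rw [Real.cos_zero, Real.cos_pi, intervalIntegral.integral_symm (-1) 1, ← neg_eq_iff_eq_neg,
    ← intervalIntegral.integral_neg] at h
  rw [← h]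
  refine intervalIntegral.integral_congr fun θ hθ => ?_
  rw [Set.uIcc_of_le Real.pi_pos.le] at hθ
  have hs : Real.sqrt (1 - Real.cos θ ^ 2) = Real.sin θ := by
    rw [← Real.sin_sq, Real.sqrt_sq (Real.sin_nonneg_of_mem_Icc hθ)]
  simp only [Function.comp_apply, hs]
  ring

theorem gegEigen_eq_integral (hd : 2 ≤ d) (ℓ p : ℕ) :
    gegEigen d ℓ p = sphereArea (d - 1) *
      ∫ t in (-1 : ℝ)..1, (gegenbauer d ℓ).eval t ^ (p + 1) * Real.sqrt (1 - t ^ 2) ^ (d - 2) := by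
  obtain ⟨e, rfl⟩ := Nat.exists_eq_add_of_le' hd
  have h1 := integral_mul_sqrt_one_sub_sq_pow (gegenbauer (e + 2) ℓ ^ (p + 1)) e
  have h2 := integral_eval_sphereInner (e + 1) (Classical.arbitrary _)
    (gegenbauer (e + 2) ℓ ^ (p + 1))
  simp only [Polynomial.eval_pow] at h1 h2
  rw [Nat.add_sub_cancel, h1, show e + 2 - 1 = e + 1 by omega, ← h2]
  rfl

theorem gammaHat_eq (hd : 2 ≤ d) (ℓ r : ℕ) :
    gammaHat d ℓ r = harmDim d ℓ / sphereArea d * gegEigen d ℓ r := by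
  rw [gegEigen_eq_integral hd, gammaHat]
  ring

/-! ### Sums of products of Gaunt integrals -/

theorem sum_gaunt_mul_gaunt (hd : 2 ≤ d) {ℓ : ℕ} {Y : Fin (harmDim d ℓ) → USphere d → ℝ}
    (hY : IsHarmonicONB d ℓ Y) (r q : ℕ) (n : Fin (harmDim d ℓ)) (k : Fin q → Fin (harmDim d ℓ)) :
    ∑ m : Fin r → Fin (harmDim d ℓ),
        gaunt Y (Fin.snoc (α := fun _ => Fin (harmDim d ℓ)) m n) * gaunt Y (Fin.append m k)
      = ((harmDim d ℓ : ℝ) / sphereArea d) ^ ((r : ℤ) - 1) * gammaHat d ℓ r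
          * gaunt Y (Fin.cons (α := fun _ => Fin (harmDim d ℓ)) n k) := by
  have hd1 : 1 ≤ d := by omega
  have hcont := hY.continuous
  have hn : (harmDim d ℓ : ℝ) ≠ 0 := by exact_mod_cast n.pos.ne'
  have hne : (harmDim d ℓ : ℝ) / sphereArea d ≠ 0 := div_ne_zero hn (sphereArea_pos d).ne'
  have hpow : ((harmDim d ℓ : ℝ) / sphereArea d) ^ ((r : ℤ) - 1) * gammaHat d ℓ r =
      ((harmDim d ℓ : ℝ) / sphereArea d) ^ r * gegEigen d ℓ r := by
    rw [gammaHat_eq hd, zpow_sub_one₀ hne, zpow_natCast, mul_assoc, inv_mul_cancel_left₀ hne]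
  have hA : ∀ m : Fin r → Fin (harmDim d ℓ),
      Continuous fun x => (∏ i, Y (m i) x) * Y n x := fun m =>
    (continuous_finsetProd _ fun i _ => hcont (m i)).mul (hcont n)
  have hB : ∀ m : Fin r → Fin (harmDim d ℓ),
      Continuous fun y => (∏ i, Y (m i) y) * ∏ i, Y (k i) y := fun m =>
    (continuous_finsetProd _ fun i _ => hcont (m i)).mul
      (continuous_finsetProd _ fun i _ => hcont (k i))
  -- Summing over `m` under the integral signs turns the products of harmonics into `G ^ r`.
  have hsum : ∀ x y, ∑ m : Fin r → Fin (harmDim d ℓ),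
      ((∏ i, Y (m i) y) * ∏ i, Y (k i) y) * ((∏ i, Y (m i) x) * Y n x) =
      ((harmDim d ℓ / sphereArea d) ^ r * ∏ i, Y (k i) y) * (gegK d ℓ x y ^ r * Y n x) := by
    intro x y
    have h := sum_harmonic_mul_harmonic hd1 hY x y
    have hp := Fintype.sum_pow (fun m => Y m x * Y m y) r
    rw [h, mul_pow] at hp
    have h1 : ∀ m : Fin r → Fin (harmDim d ℓ),
        ((∏ i, Y (m i) y) * ∏ i, Y (k i) y) * ((∏ i, Y (m i) x) * Y n x) =
        (∏ i, (Y (m i) x * Y (m i) y)) * ((∏ i, Y (k i) y) * Y n x) := fun m => by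
      rw [Finset.prod_mul_distrib]; ring
    simp only [h1]
    rw [← Finset.sum_mul, ← hp]
    ring
  calc
    _ = ∑ m : Fin r → Fin (harmDim d ℓ),
          ∫ y, ∫ x, ((∏ i, Y (m i) y) * ∏ i, Y (k i) y) * ((∏ i, Y (m i) x) * Y n x)
            ∂(sphereMeasure d) ∂(sphereMeasure d) := by
        refine Finset.sum_congr rfl fun m _ => ?_
        simp only [integral_const_mul, integral_mul_const, gaunt, Fin.prod_univ_castSucc,
          Fin.prod_univ_add, Fin.snoc_castSucc, Fin.snoc_last, Fin.append_left, Fin.append_right]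
        ring
    _ = ∫ y, ∫ x, ∑ m : Fin r → Fin (harmDim d ℓ),
          ((∏ i, Y (m i) y) * ∏ i, Y (k i) y) * ((∏ i, Y (m i) x) * Y n x)
            ∂(sphereMeasure d) ∂(sphereMeasure d) := by
        rw [← integral_finsetSum]
        · congr 1
          ext y
          rw [integral_finsetSum _ fun m _ => ((hA m).integrable_sphereMeasure).const_mul _]
        · intro m _
          simp only [integral_const_mul]
          exact ((hB m).integrable_sphereMeasure).mul_const _
    _ = ∫ y, ((harmDim d ℓ / sphereArea d) ^ r * gegEigen d ℓ r) * (Y n y * ∏ i, Y (k i) y)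
          ∂(sphereMeasure d) := by
        congr 1
        ext y
        simp only [hsum, integral_const_mul]
        rw [integral_gegK_pow_mul hd1 ℓ r (hY.mem n) y]
        ring
    _ = _ := by
        rw [integral_const_mul, hpow]
        simp only [gaunt, Fin.prod_univ_succ, Fin.cons_zero, Fin.cons_succ]

/-! ### Integrating out one vertex -/

/-- Fubini's theorem for continuous functions on `(𝕊^d)^(n+1)`: the variable of index `i` is
integrated first. -/
theorem integral_sphereMeasurePow_succ {n : ℕ} (i : Fin (n + 1))
    {F : (Fin (n + 1) → USphere d) → ℝ} (hF : Continuous F) :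
    ∫ x, F x ∂(sphereMeasurePow d (n + 1)) =
      ∫ x, ∫ a, F (i.insertNth a x) ∂(sphereMeasure d) ∂(sphereMeasurePow d n) := by
  have h := ((measurePreserving_piFinSuccAbove (fun _ : Fin (n + 1) => sphereMeasure d) i).symm
    _).integral_comp' F
  rw [sphereMeasurePow, ← h, integral_prod_symm]
  · rfl
  · refine Continuous.integrable_of_hasCompactSupport ?_ (HasCompactSupport.of_compactSpace _)
    exact hF.comp (by
      simp only [MeasurableEquiv.piFinSuccAbove_symm_apply]
      exact Continuous.finInsertNth (A := fun _ => USphere d) i continuous_fst continuous_snd)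

/-- The Funk-Hecke formula for the zonal harmonic with pole `y`: integrating out a vertex with two
neighbours, one of them joined by a simple edge. -/
theorem integral_gegK_mul_gegK_pow (hd : 1 ≤ d) (ℓ p : ℕ) (y z : USphere d) :
    ∫ x, gegK d ℓ x y * gegK d ℓ x z ^ p ∂(sphereMeasure d) = gegEigen d ℓ p * gegK d ℓ y z := by
  rw [gegK_comm, ← integral_gegK_pow_mul hd ℓ p (gegK_mem_sphericalHarmonics hd ℓ y) z]
  simp only [mul_comm]

theorem gegMoment_succ (hd : 1 ≤ d) (ℓ p : ℕ) :
    gegMoment d ℓ (p + 1) = sphereArea d * gegEigen d ℓ p := by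
  have hF : Continuous fun x : Fin 2 → USphere d => gegK d ℓ (x 0) (x 1) ^ (p + 1) :=
    by fun_prop
  rw [gegMoment, integral_sphereMeasurePow_succ 0 hF]
  have h1 : ∀ (x : Fin 1 → USphere d) (a : USphere d),
      (Fin.insertNth 0 a x : Fin 2 → USphere d) 1 = x 0 := fun _ _ => rfl
  simp only [Fin.insertNth_apply_same, h1, integral_gegK_pow_succ hd]
  simp [sphereMeasurePow, sphereArea, measureReal_def, Measure.pi_univ]

/-- The vertex `0` of a triangle is integrated out; its edge to the vertex `1` is simple. -/
theorem integral_triangle (hd : 1 ≤ d) (ℓ q₁ q₂ : ℕ) :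
    ∫ x : Fin 3 → USphere d,
        gegK d ℓ (x 0) (x 1) * gegK d ℓ (x 0) (x 2) ^ q₁ * gegK d ℓ (x 1) (x 2) ^ q₂
        ∂(sphereMeasurePow d 3) = gegEigen d ℓ q₁ * gegMoment d ℓ (q₂ + 1) := by
  rw [integral_sphereMeasurePow_succ 0 (by fun_prop)]
  have h1 : ∀ (x : Fin 2 → USphere d) (a : USphere d),
      (Fin.insertNth 0 a x : Fin 3 → USphere d) 1 = x 0 := fun _ _ => rfl
  have h2 : ∀ (x : Fin 2 → USphere d) (a : USphere d),
      (Fin.insertNth 0 a x : Fin 3 → USphere d) 2 = x 1 := fun _ _ => rfl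
  simp only [Fin.insertNth_apply_same, h1, h2, integral_mul_const,
    integral_gegK_mul_gegK_pow hd]
  rw [gegMoment, ← integral_const_mul]
  congr 1
  ext x
  ring

/-- The vertex `0` of a triangle is integrated out; its edge to the vertex `2` is simple. -/
theorem integral_triangle_swap (hd : 1 ≤ d) (ℓ q₁ q₂ : ℕ) :
    ∫ x : Fin 3 → USphere d,
        gegK d ℓ (x 0) (x 2) * gegK d ℓ (x 0) (x 1) ^ q₁ * gegK d ℓ (x 1) (x 2) ^ q₂
        ∂(sphereMeasurePow d 3) = gegEigen d ℓ q₁ * gegMoment d ℓ (q₂ + 1) := by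
  rw [integral_sphereMeasurePow_succ 0 (by fun_prop)]
  have h1 : ∀ (x : Fin 2 → USphere d) (a : USphere d),
      (Fin.insertNth 0 a x : Fin 3 → USphere d) 1 = x 0 := fun _ _ => rfl
  have h2 : ∀ (x : Fin 2 → USphere d) (a : USphere d),
      (Fin.insertNth 0 a x : Fin 3 → USphere d) 2 = x 1 := fun _ _ => rfl
  simp only [Fin.insertNth_apply_same, h1, h2, integral_mul_const,
    integral_gegK_mul_gegK_pow hd]
  rw [gegMoment, ← integral_const_mul]
  congr 1
  ext x
  rw [gegK_comm ℓ (x 1)]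
  ring

/-- The vertex `1` of a triangle is integrated out; its edge to the vertex `2` is simple. -/
theorem integral_triangle_middle (hd : 1 ≤ d) (ℓ q₁ q₂ : ℕ) :
    ∫ x : Fin 3 → USphere d,
        gegK d ℓ (x 1) (x 2) * gegK d ℓ (x 1) (x 0) ^ q₁ * gegK d ℓ (x 0) (x 2) ^ q₂
        ∂(sphereMeasurePow d 3) = gegEigen d ℓ q₁ * gegMoment d ℓ (q₂ + 1) := by
  rw [integral_sphereMeasurePow_succ 1 (by fun_prop)]
  have h1 : ∀ (x : Fin 2 → USphere d) (a : USphere d),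
      (Fin.insertNth 1 a x : Fin 3 → USphere d) 0 = x 0 := fun _ _ => rfl
  have h2 : ∀ (x : Fin 2 → USphere d) (a : USphere d),
      (Fin.insertNth 1 a x : Fin 3 → USphere d) 2 = x 1 := fun _ _ => rfl
  simp only [Fin.insertNth_apply_same, h1, h2, integral_mul_const,
    integral_gegK_mul_gegK_pow hd]
  rw [gegMoment, ← integral_const_mul]
  congr 1
  ext x
  rw [gegK_comm ℓ (x 1)]
  ring

/-- The vertex `0` of a graph on four vertices, joined to `1` by a simple edge and to `3` by an
edge of multiplicity `q`, is integrated out; a simple edge from `1` to `3` replaces it. -/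
theorem integral_four_vertices (hd : 1 ≤ d) (ℓ q : ℕ) {F : USphere d → USphere d → USphere d → ℝ}
    (hF : Continuous fun x : Fin 4 → USphere d => F (x 1) (x 2) (x 3)) :
    ∫ x : Fin 4 → USphere d,
        gegK d ℓ (x 0) (x 1) * gegK d ℓ (x 0) (x 3) ^ q * F (x 1) (x 2) (x 3)
        ∂(sphereMeasurePow d 4) =
      gegEigen d ℓ q * ∫ x : Fin 3 → USphere d, gegK d ℓ (x 0) (x 2) * F (x 0) (x 1) (x 2)
        ∂(sphereMeasurePow d 3) := by
  have hG : Continuous fun x : Fin 4 → USphere d =>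
      gegK d ℓ (x 0) (x 1) * gegK d ℓ (x 0) (x 3) ^ q := by fun_prop
  rw [integral_sphereMeasurePow_succ 0 (by exact hG.mul hF), ← integral_const_mul]
  have h1 : ∀ (x : Fin 3 → USphere d) (a : USphere d),
      (Fin.insertNth 0 a x : Fin 4 → USphere d) 1 = x 0 := fun _ _ => rfl
  have h2 : ∀ (x : Fin 3 → USphere d) (a : USphere d),
      (Fin.insertNth 0 a x : Fin 4 → USphere d) 2 = x 1 := fun _ _ => rfl
  have h3 : ∀ (x : Fin 3 → USphere d) (a : USphere d),
      (Fin.insertNth 0 a x : Fin 4 → USphere d) 3 = x 2 := fun _ _ => rfl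
  simp only [Fin.insertNth_apply_same, h1, h2, h3, integral_mul_const,
    integral_gegK_mul_gegK_pow hd]
  simp only [mul_assoc]

theorem integral_square (hd : 1 ≤ d) (ℓ q₁ q₂ q₃ : ℕ) :
    ∫ x : Fin 4 → USphere d,
        gegK d ℓ (x 0) (x 1) * gegK d ℓ (x 0) (x 3) ^ q₁ * gegK d ℓ (x 1) (x 2) ^ q₂
          * gegK d ℓ (x 2) (x 3) ^ q₃
        ∂(sphereMeasurePow d 4) =
      gegEigen d ℓ q₁ * (gegEigen d ℓ q₂ * gegMoment d ℓ (q₃ + 1)) := by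
  have h := integral_four_vertices hd ℓ q₁
    (F := fun a b c => gegK d ℓ a b ^ q₂ * gegK d ℓ b c ^ q₃) (by fun_prop)
  simp only [← mul_assoc] at h
  rw [h]
  congr 1
  exact integral_triangle_swap hd ℓ q₂ q₃

theorem integral_square_with_diagonal (hd : 1 ≤ d) (ℓ q₁ q₂ q₃ : ℕ) :
    ∫ x : Fin 4 → USphere d,
        gegK d ℓ (x 0) (x 1) * gegK d ℓ (x 0) (x 3) ^ q₁ * gegK d ℓ (x 1) (x 2) ^ q₂
          * gegK d ℓ (x 1) (x 3) ^ q₃ * gegK d ℓ (x 2) (x 3)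
        ∂(sphereMeasurePow d 4) =
      gegEigen d ℓ q₁ * (gegEigen d ℓ q₂ * gegMoment d ℓ (q₃ + 2)) := by
  have h := integral_four_vertices hd ℓ q₁
    (F := fun a b c => gegK d ℓ a b ^ q₂ * gegK d ℓ a c ^ q₃ * gegK d ℓ b c) (by fun_prop)
  simp only [← mul_assoc] at h
  rw [h]
  congr 1
  rw [← integral_triangle_middle hd]
  congr 1
  ext x
  rw [gegK_comm ℓ (x 1) (x 0)]
  ring

end

theorem mainTheorem4 (d : ℕ) (hd : 2 ≤ d) :
    (∀ (ℓ : ℕ) (Y : Fin (harmDim d ℓ) → USphere d → ℝ), IsHarmonicONB d ℓ Y →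
      ∀ (r q : ℕ) (n : Fin (harmDim d ℓ)) (k : Fin q → Fin (harmDim d ℓ)),
        ∑ m : Fin r → Fin (harmDim d ℓ),
            gaunt Y (Fin.snoc (α := fun _ => Fin (harmDim d ℓ)) m n) * gaunt Y (Fin.append m k)
          = ((harmDim d ℓ : ℝ) / sphereArea d) ^ ((r : ℤ) - 1) * gammaHat d ℓ r
              * gaunt Y (Fin.cons (α := fun _ => Fin (harmDim d ℓ)) n k)) ∧
    (∃ c₁ : ℝ, 0 < c₁ ∧ ∀ ℓ q₁ q₂ : ℕ, 2 ≤ q₁ → 2 ≤ q₂ →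
      ∫ x : Fin 3 → USphere d,
          gegK d ℓ (x 0) (x 1) * gegK d ℓ (x 0) (x 2) ^ q₁ * gegK d ℓ (x 1) (x 2) ^ q₂
          ∂(sphereMeasurePow d 3)
        = c₁ * (gegMoment d ℓ (q₁ + 1) * gegMoment d ℓ (q₂ + 1))) ∧
    (∃ c₂ : ℝ, 0 < c₂ ∧ ∀ ℓ q₁ q₂ q₃ : ℕ, 2 ≤ q₁ → 2 ≤ q₂ → 1 ≤ q₃ →
      ∫ x : Fin 4 → USphere d,
          gegK d ℓ (x 0) (x 1) * gegK d ℓ (x 0) (x 3) ^ q₁ * gegK d ℓ (x 1) (x 2) ^ q₂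
            * gegK d ℓ (x 2) (x 3) ^ q₃
          ∂(sphereMeasurePow d 4)
        = c₂ * (gegMoment d ℓ (q₁ + 1) * gegMoment d ℓ (q₂ + 1) * gegMoment d ℓ (q₃ + 1))) ∧
    (∃ c₃ : ℝ, 0 < c₃ ∧ ∀ ℓ q₁ q₂ q₃ : ℕ, 2 ≤ q₁ → 2 ≤ q₂ →
      ∫ x : Fin 4 → USphere d,
          gegK d ℓ (x 0) (x 1) * gegK d ℓ (x 0) (x 3) ^ q₁ * gegK d ℓ (x 1) (x 2) ^ q₂
            * gegK d ℓ (x 1) (x 3) ^ q₃ * gegK d ℓ (x 2) (x 3)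
          ∂(sphereMeasurePow d 4)
        = c₃ * (gegMoment d ℓ (q₁ + 1) * gegMoment d ℓ (q₂ + 1) * gegMoment d ℓ (q₃ + 2))) := by
  have hd1 : 1 ≤ d := by omega
  have hμ := sphereArea_pos d
  refine ⟨fun ℓ Y hY r q n k => sum_gaunt_mul_gaunt hd hY r q n k,
    ⟨(sphereArea d)⁻¹, by positivity, fun ℓ q₁ q₂ _ _ => ?_⟩,
    ⟨(sphereArea d)⁻¹ ^ 2, by positivity, fun ℓ q₁ q₂ q₃ _ _ _ => ?_⟩,
    ⟨(sphereArea d)⁻¹ ^ 2, by positivity, fun ℓ q₁ q₂ q₃ _ _ => ?_⟩⟩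
  · rw [integral_triangle hd1, gegMoment_succ hd1 ℓ q₁]
    field_simp
  · rw [integral_square hd1, gegMoment_succ hd1 ℓ q₁, gegMoment_succ hd1 ℓ q₂]
    field_simp
  · rw [integral_square_with_diagonal hd1, gegMoment_succ hd1 ℓ q₁, gegMoment_succ hd1 ℓ q₂]
    field_simp
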